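/- All graphs are finite and simple. A cactus is a connected graph in which any two distinct cycles have at most one common vertex. For a graph $G$ let $Q(G)=D(G)+A(G)$ be its signless Laplacian matrix (the diagonal degree matrix plus the adjacency matrix), and let $q(G)$ be the largest eigenvalue of $Q(G)$. The matching number of $G$ is the largest number of edges in a matching of $G$. For integers $s,k\ge 0$ let $H_s^k$ be the graph consisting of $s$ triangles and $k$ pendant edges that all share exactly one vertex (so it has $2s+k+1$ vertices). **Theorem 3.1.** Let $G$ be a cactus on $n$ vertices with matching number $m\ge 1$. (i) If $n=2m+1$, then $$q(G)\le \frac{(n+2)+\sqrt{n^2-4n+12}}{2},$$ with equality if and only if $G\cong H_m^0$. (ii) If $n\ge 2m+2$, then $$q(G)\le q\bigl(H_{m-1}^{\,n-2m+1}\bigr),$$ with equality if and only if $G\cong H_{m-1}^{\,n-2m+1}$; moreover, $q\bigl(H_{m-1}^{\,n-2m+1}\bigr)$ is the largest real root of the equation $x^3-(n+3)x^2+3nx-4m+4=0$. -/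

import Mathlib

namespace SimpleGraph

/-- A cactus: a connected graph in which any two distinct cycles have at most one common vertex.
Two closed walks that are cycles are the same cycle of `G` when they trace the same subgraph
(so the base point and the orientation do not matter). -/
def IsCactus {V : Type*} (G : SimpleGraph V) : Prop :=
  G.Connected ∧
    ∀ (u v : V) (c : G.Walk u u) (d : G.Walk v v), c.IsCycle → d.IsCycle →
      c.toSubgraph ≠ d.toSubgraph →
      ∀ x y : V, x ∈ c.support → x ∈ d.support → y ∈ c.support → y ∈ d.support → x = y

/-- The matching number: the largest number of edges of a matching of the finite graph `G`. -/
noncomputable def matchingNumber {V : Type*} [Fintype V] (G : SimpleGraph V) : ℕ :=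
  sSup {k : ℕ | ∃ M : G.Subgraph, M.IsMatching ∧ M.edgeSet.ncard = k}

/-- The signless Laplacian matrix, the sum of the diagonal degree matrix and the adjacency
matrix. -/
def signlessLapMatrix {V : Type*} [Fintype V] [DecidableEq V] (G : SimpleGraph V)
    [DecidableRel G.Adj] : Matrix V V ℝ :=
  G.degMatrix ℝ + G.adjMatrix ℝ

open Classical in
/-- The signless Laplacian spectral radius: the largest eigenvalue of the signless Laplacian
matrix (a real symmetric matrix). -/
noncomputable def signlessRadius {V : Type*} [Fintype V] (G : SimpleGraph V) : ℝ :=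
  sSup (spectrum ℝ G.signlessLapMatrix)

/-- `s` triangles and `k` pendant edges sharing exactly one vertex, the vertex `none`.
The `i`-th triangle is formed by `none` and the two vertices `some (Sum.inl (i, 0))` and
`some (Sum.inl (i, 1))`; the `j`-th pendant edge joins `none` and `some (Sum.inr j)`. -/
def triangleBundle (s k : ℕ) : SimpleGraph (Option ((Fin s × Fin 2) ⊕ Fin k)) where
  Adj
    | none, some _ => True
    | some _, none => True
    | some (Sum.inl (i, a)), some (Sum.inl (j, b)) => i = j ∧ a ≠ b
    | _, _ => False
  symm := ⟨by
    rintro (_ | ⟨⟨i, a⟩ | x⟩) (_ | ⟨⟨j, b⟩ | y⟩) h <;> simp_all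
    exact fun e => h.2 e.symm⟩
  loopless := ⟨by rintro (_ | ⟨⟨i, a⟩ | x⟩) h <;> simp_all⟩

end SimpleGraph

/-! The proof splits on whether some vertex is adjacent to all others.

If `v` dominates, two edges `xy`, `xz` avoiding `v` with `y ≠ z` would put two triangles on the edge
`vx`, which a cactus forbids. So `G - v` is a matching plus isolated vertices, and `G` is a
`triangleBundle s k`. Its radius is a root of `x(x-3)(x-n) = 4s`, hence grows with `s` when `n` is
fixed, and the matching number caps `s`: at `m` if `n = 2m+1`, at `m-1` if `n ≥ 2m+2`, because a
pendant edge then enlarges the matching.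

If no vertex dominates, the degree vector is a test vector: `IsCactus.sum_degree_neighbors_le` gives
`Q d ≤ n d`, so the radius is at most `n`. The only obstruction to that inequality produces a
perfect matching (`IsCactus.card_le_two_mul_matchingNumber`), excluded by `2m < n`. Such a graph has
`m ≥ 2`, and then the extremal radius strictly exceeds `n`. -/

/-! ### Spectral bounds from positive test vectors. -/

open Matrix in
theorem Matrix.le_of_mem_spectrum_of_mulVec_le {ι : Type*} [Fintype ι] [DecidableEq ι]
    {A : Matrix ι ι ℝ} (hA : ∀ i j, 0 ≤ A i j) {y : ι → ℝ} (hy : ∀ i, 0 < y i) {c : ℝ}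
    (h : ∀ i, (A *ᵥ y) i ≤ c * y i) {μ : ℝ} (hμ : μ ∈ spectrum ℝ A) : μ ≤ c := by
  rw [← Matrix.spectrum_toLin', ← Module.End.hasEigenvalue_iff_mem_spectrum] at hμ
  obtain ⟨x, hx⟩ := hμ.exists_hasEigenvector
  have hx0 := hx.2
  have hxe : A *ᵥ x = μ • x := by simpa using hx.apply_eq_smul
  obtain ⟨i₀, hi₀⟩ := Function.ne_iff.mp hx0
  have : Nonempty ι := ⟨i₀⟩
  -- Collatz–Wielandt argument: where `|x i| / y i` is maximal, row `i` of `A x` is at most `t`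
  -- times row `i` of `A y` in absolute value.
  obtain ⟨i, hi⟩ := Finite.exists_max fun i => |x i| / y i
  set t := |x i| / y i
  have ht : ∀ j, |x j| ≤ t * y j := fun j => (div_le_iff₀ (hy j)).mp (hi j)
  have htpos : 0 < t :=
    lt_of_lt_of_le (div_pos (abs_pos.mpr hi₀) (hy i₀)) (hi i₀)
  have hxi : |x i| = t * y i := (div_mul_cancel₀ _ (hy i).ne').symm
  have key : |μ| * |x i| ≤ t * (c * y i) := by
    calc |μ| * |x i| = |(A *ᵥ x) i| := by rw [hxe, Pi.smul_apply, smul_eq_mul, abs_mul]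
      _ = |∑ j, A i j * x j| := rfl
      _ ≤ ∑ j, |A i j * x j| := Finset.abs_sum_le_sum_abs _ _
      _ ≤ ∑ j, t * (A i j * y j) := by
        refine Finset.sum_le_sum fun j _ => ?_
        rw [abs_mul, abs_of_nonneg (hA i j)]
        nlinarith [mul_le_mul_of_nonneg_left (ht j) (hA i j)]
      _ = t * (A *ᵥ y) i := by rw [← Finset.mul_sum]; rfl
      _ ≤ t * (c * y i) := mul_le_mul_of_nonneg_left (h i) htpos.le
  rw [hxi] at key
  have : |μ| * (t * y i) ≤ c * (t * y i) := by linarith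
  exact (le_abs_self μ).trans (le_of_mul_le_mul_right this (mul_pos htpos (hy i)))

namespace SimpleGraph

section Radius

variable {V : Type*} [Fintype V] (G : SimpleGraph V)

open Matrix in
theorem signlessLapMatrix_mulVec_apply [DecidableEq V] [DecidableRel G.Adj] (x : V → ℝ) (v : V) :
    (G.signlessLapMatrix *ᵥ x) v = G.degree v * x v + ∑ u ∈ G.neighborFinset v, x u := by
  simp [signlessLapMatrix, add_mulVec, degMatrix, mulVec_diagonal]

theorem signlessLapMatrix_nonneg [DecidableEq V] [DecidableRel G.Adj] (i j : V) :
    0 ≤ G.signlessLapMatrix i j := by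
  simp only [signlessLapMatrix, degMatrix, Matrix.add_apply, Matrix.diagonal_apply,
    adjMatrix_apply]
  positivity

open Classical in
/-- A positive vector `y` with `Q y ≤ c y` bounds the signless Laplacian spectral radius. -/
theorem signlessRadius_le {y : V → ℝ} (hy : ∀ v, 0 < y v) {c : ℝ} (hc : 0 ≤ c)
    (h : ∀ v, G.degree v * y v + ∑ u ∈ G.neighborFinset v, y u ≤ c * y v) :
    G.signlessRadius ≤ c := by
  refine Real.sSup_le (fun μ hμ => ?_) hc
  refine Matrix.le_of_mem_spectrum_of_mulVec_le G.signlessLapMatrix_nonneg hy (fun i => ?_) hμ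
  rw [signlessLapMatrix_mulVec_apply]
  exact h i

open Classical in
/-- The eigenvalue of a positive eigenvector is the signless Laplacian spectral radius. -/
theorem signlessRadius_eq [Nonempty V] {y : V → ℝ} (hy : ∀ v, 0 < y v) {c : ℝ}
    (h : ∀ v, G.degree v * y v + ∑ u ∈ G.neighborFinset v, y u = c * y v) :
    G.signlessRadius = c := by
  refine IsGreatest.csSup_eq ⟨?_, fun μ hμ => ?_⟩
  · rw [← Matrix.spectrum_toLin', ← Module.End.hasEigenvalue_iff_mem_spectrum]
    refine Module.End.hasEigenvalue_of_hasEigenvector (x := y)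
      ⟨Module.End.mem_eigenspace_iff.mpr ?_, fun h0 => ?_⟩
    · ext v
      rw [Matrix.toLin'_apply, signlessLapMatrix_mulVec_apply, h v]
      rfl
    · obtain ⟨v⟩ := ‹Nonempty V›
      exact (hy v).ne' (congrFun h0 v)
  · refine Matrix.le_of_mem_spectrum_of_mulVec_le G.signlessLapMatrix_nonneg hy (fun i => ?_) hμ
    rw [signlessLapMatrix_mulVec_apply]
    exact (h i).le

end Radius

theorem Iso.signlessRadius_eq {V W : Type*} [Fintype V] [Fintype W] {G : SimpleGraph V}
    {H : SimpleGraph W} (e : G ≃g H) : G.signlessRadius = H.signlessRadius := by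
  classical
  unfold signlessRadius
  rw [← AlgEquiv.spectrum_eq (Matrix.reindexAlgEquiv ℝ ℝ e.toEquiv)]
  congr 2
  ext i j
  have hd : G.degree (e.symm i) = H.degree i := e.symm.degree_eq i
  have ha : G.Adj (e.symm i) (e.symm j) ↔ H.Adj i j := e.symm.map_adj_iff
  have he : e.toEquiv.symm i = e.symm i := rfl
  have hf : e.toEquiv.symm j = e.symm j := rfl
  simp only [signlessLapMatrix, degMatrix, Matrix.coe_reindexAlgEquiv, Matrix.reindex_apply,
    Matrix.submatrix_apply, Matrix.add_apply, Matrix.diagonal_apply, adjMatrix_apply, he, hf,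
    ha, e.symm.injective.eq_iff, hd]

/-! ### Matchings encoded as involutions. -/

section Matching

variable {V : Type*} [Fintype V] (G : SimpleGraph V)

/-- An involution that moves vertices only along edges yields a matching on the moved vertices. -/
theorem card_moved_le_two_mul_matchingNumber [DecidableEq V] {f : V → V}
    (hf : Function.Involutive f) (hadj : ∀ x, f x ≠ x → G.Adj x (f x)) :
    (Finset.univ.filter fun x => f x ≠ x).card ≤ 2 * G.matchingNumber := by
  classical
  let M : G.Subgraph :=
    { verts := {x | f x ≠ x}
      Adj := fun x y => f x = y ∧ x ≠ y
      adj_sub := by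
        rintro x y ⟨rfl, h⟩
        exact hadj x h.symm
      edge_vert := by
        rintro x y ⟨rfl, h⟩
        exact h.symm
      symm := ⟨by
        rintro x y ⟨rfl, h⟩
        exact ⟨hf x, h.symm⟩⟩ }
  have hM : M.IsMatching := fun x hx => ⟨f x, ⟨rfl, fun h => hx h.symm⟩, fun y hy => hy.1.symm⟩
  have hcard : (Finset.univ.filter fun x => f x ≠ x).card ≤ 2 * M.edgeSet.ncard := by
    refine (Finset.card_le_mul_card_image (f := fun x => s(x, f x)) _ 2 ?_).trans ?_
    · intro e he
      obtain ⟨x, -, rfl⟩ := Finset.mem_image.mp he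
      refine (Finset.card_le_card (t := {x, f x}) fun y hy => ?_).trans Finset.card_le_two
      have := (Finset.mem_filter.mp hy).2
      simp only [Sym2.eq_iff] at this
      simp only [Finset.mem_insert, Finset.mem_singleton]
      tauto
    · refine Nat.mul_le_mul_left 2 ?_
      rw [← Set.ncard_coe_finset]
      refine Set.ncard_le_ncard (fun e he => ?_) (Set.toFinite _)
      obtain ⟨x, hx, rfl⟩ := Finset.mem_image.mp he
      exact ⟨rfl, fun h => (Finset.mem_filter.mp hx).2 h.symm⟩
  refine hcard.trans (Nat.mul_le_mul_left 2 (le_csSup ⟨(Set.univ : Set (Sym2 V)).ncard, ?_⟩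
    ⟨M, hM, rfl⟩))
  rintro k ⟨M', -, rfl⟩
  exact Set.ncard_le_ncard (Set.subset_univ _) (Set.toFinite _)

theorem Iso.card_moved_le_two_mul_matchingNumber {V W : Type*} [Fintype V] [Fintype W]
    [DecidableEq W] {G : SimpleGraph V} {H : SimpleGraph W} (e : G ≃g H) {f : W → W}
    (hf : Function.Involutive f) (hadj : ∀ x, f x ≠ x → H.Adj x (f x)) :
    (Finset.univ.filter fun x => f x ≠ x).card ≤ 2 * G.matchingNumber := by
  classical
  refine le_trans ?_ (G.card_moved_le_two_mul_matchingNumber (f := fun x => e.symm (f (e x)))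
    (fun x => by simp [hf (e x)]) fun x hx => ?_)
  · refine Finset.card_le_card_of_injOn e.symm (fun x hx => ?_) e.symm.injective.injOn
    simp at hx ⊢
    exact hx
  · have : f (e x) ≠ e x := fun h => hx (by simp [h])
    simpa using e.symm.map_adj_iff.mpr (hadj _ this)

end Matching

end SimpleGraph

/-! ### Triangles and quadrangles in a cactus. -/

namespace SimpleGraph

variable {V : Type*} {G : SimpleGraph V}

/-- Two cycles of a cactus with two common vertices have the same vertices. -/
theorem IsCactus.mem_support_of_two_common (hG : G.IsCactus) {u v a b x : V} {c : G.Walk u u}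
    {d : G.Walk v v} (hc : c.IsCycle) (hd : d.IsCycle) (hab : a ≠ b) (hac : a ∈ c.support)
    (hbc : b ∈ c.support) (had : a ∈ d.support) (hbd : b ∈ d.support) (hx : x ∈ c.support) :
    x ∈ d.support := by
  by_contra hxd
  refine hab (hG.2 u v c d hc hd (fun h => hxd ?_) a b hac had hbc hbd)
  rw [← Walk.mem_verts_toSubgraph, ← h, Walk.mem_verts_toSubgraph]
  exact hx

theorem exists_isCycle_triangle {a b c : V} (hab : G.Adj a b) (hbc : G.Adj b c)
    (hca : G.Adj c a) :
    ∃ p : G.Walk a a, p.IsCycle ∧ ∀ x, x ∈ p.support ↔ x = a ∨ x = b ∨ x = c := by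
  refine ⟨.cons hab (.cons hbc (.cons hca .nil)), ?_, fun x => ?_⟩
  · have := hab.ne; have := hbc.ne; have := hca.ne
    simp [Walk.cons_isCycle_iff, Walk.cons_isPath_iff]
    grind
  · simp
    grind

theorem exists_isCycle_square {a b c d : V} (hab : G.Adj a b) (hbc : G.Adj b c)
    (hcd : G.Adj c d) (hda : G.Adj d a) (hac : a ≠ c) (hbd : b ≠ d) :
    ∃ p : G.Walk a a, p.IsCycle ∧ ∀ x, x ∈ p.support ↔ x = a ∨ x = b ∨ x = c ∨ x = d := by
  refine ⟨.cons hab (.cons hbc (.cons hcd (.cons hda .nil))), ?_, fun x => ?_⟩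
  · have := hab.ne; have := hbc.ne; have := hcd.ne; have := hda.ne
    simp [Walk.cons_isCycle_iff, Walk.cons_isPath_iff]
    grind
  · simp
    grind

/-- In a cactus, an edge `v u` lies in at most one triangle or quadrangle. The third vertex of a
triangle and the vertex opposite to `v` of a quadrangle are treated alike. -/
theorem IsCactus.eq_of_short_cycles (hG : G.IsCactus) {v u y z : V} (hvu : G.Adj v u)
    (huy : G.Adj u y) (huz : G.Adj u z)
    (hy : G.Adj v y ∨ (y ≠ v ∧ ¬ G.Adj v y ∧ ∃ t, t ≠ u ∧ G.Adj v t ∧ G.Adj y t))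
    (hz : G.Adj v z ∨ (z ≠ v ∧ ¬ G.Adj v z ∧ ∃ t, t ≠ u ∧ G.Adj v t ∧ G.Adj z t)) : y = z := by
  have key : ∀ y, G.Adj u y →
      (G.Adj v y ∨ (y ≠ v ∧ ¬ G.Adj v y ∧ ∃ t, t ≠ u ∧ G.Adj v t ∧ G.Adj y t)) →
      ∃ p : G.Walk v v, p.IsCycle ∧ v ∈ p.support ∧ u ∈ p.support ∧ y ∈ p.support ∧
        ∀ x ∈ p.support, x = v ∨ x = u ∨ x = y ∨ (¬ G.Adj v y ∧ G.Adj v x) := by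
    rintro y huy (hy | ⟨hyv, hy, t, htu, hvt, hyt⟩)
    · obtain ⟨p, hp, hs⟩ := exists_isCycle_triangle hvu huy hy.symm
      exact ⟨p, hp, by simp [hs], by simp [hs], by simp [hs], fun x hx => by grind⟩
    · obtain ⟨p, hp, hs⟩ := exists_isCycle_square hvu huy hyt hvt.symm hyv.symm htu.symm
      exact ⟨p, hp, by simp [hs], by simp [hs], by simp [hs], fun x hx => by grind⟩
  obtain ⟨p, hp, hvp, hup, hyp, hps⟩ := key y huy hy
  obtain ⟨q, hq, hvq, huq, hzq, hqs⟩ := key z huz hz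
  -- Both cycles contain `v` and `u`, so they have the same vertices. In a quadrangle, non-adjacency
  -- to `v` singles out the opposite vertex among those other than `v`.
  have h1 := hqs y (hG.mem_support_of_two_common hp hq hvu.ne hvp hup hvq huq hyp)
  have h2 := hps z (hG.mem_support_of_two_common hq hp hvu.ne hvq huq hvp hup hzq)
  have := huy.ne
  have := huz.ne
  have : v ≠ y := by rintro rfl; simp at hy
  have : v ≠ z := by rintro rfl; simp at hz
  grind

end SimpleGraph

/-! ### Graphs with a dominating vertex. -/

namespace SimpleGraph

/-- A graph in which every vertex has at most one neighbour is a disjoint union of edges and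
isolated vertices. -/
theorem exists_equiv_of_subsingleton_neighbors {X : Type*} [Fintype X] (G : SimpleGraph X)
    (h : ∀ x y z, G.Adj x y → G.Adj x z → y = z) :
    ∃ (s k : ℕ) (e : (Fin s × Fin 2) ⊕ Fin k ≃ X),
      (∀ i a j b, G.Adj (e (.inl (i, a))) (e (.inl (j, b))) ↔ i = j ∧ a ≠ b) ∧
      ∀ z x, ¬ G.Adj (e (.inr z)) x := by
  classical
  -- An arbitrary linear order orients each edge: `L` holds the lower ends, `p` gives the upper
  -- ends, `F` the isolated vertices.
  let r : X → ℕ := fun x => Fintype.equivFin X x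
  have hr : Function.Injective r := fun x y hxy => (Fintype.equivFin X).injective (Fin.ext hxy)
  let L := {x : X // ∃ y, G.Adj x y ∧ r x < r y}
  let F := {x : X // ∀ y, ¬ G.Adj x y}
  choose p hp hlt using fun x : L => x.2
  let g : (L × Fin 2) ⊕ F → X :=
    Sum.elim (fun q => if q.2 = 0 then q.1.1 else p q.1) fun x => x.1
  have hpL : ∀ x y : L, x.1 ≠ p y := by
    intro x y hxy
    have h1 := hp x
    have h2 := hlt x
    have h3 := h _ _ _ (hxy ▸ (hp y).symm) h1
    have h4 := hlt y
    rw [← h3] at h2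
    rw [← hxy] at h4
    omega
  have hpp : ∀ x y : L, p x = p y → x = y := fun x y hxy =>
    Subtype.ext (h _ _ _ (hp x).symm (hxy ▸ (hp y).symm))
  have hg : Function.Bijective g := by
    constructor
    · rintro (⟨x, a⟩ | x) (⟨y, b⟩ | y) hxy
      · fin_cases a <;> fin_cases b <;> simp [g] at hxy ⊢
        · exact Subtype.ext hxy
        · exact hpL _ _ hxy
        · exact hpL _ _ hxy.symm
        · exact hpp _ _ hxy
      · exfalso
        fin_cases a <;> simp [g] at hxy
        · exact y.2 _ (hxy ▸ hp x)
        · exact y.2 _ (hxy ▸ (hp x).symm)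
      · exfalso
        fin_cases b <;> simp [g] at hxy
        · exact x.2 _ (hxy ▸ hp y)
        · exact x.2 _ (hxy ▸ (hp y).symm)
      · simp [g] at hxy
        exact congrArg _ (Subtype.ext hxy)
    · intro x
      by_cases hx : ∃ y, G.Adj x y
      · obtain ⟨y, hy⟩ := hx
        rcases lt_trichotomy (r x) (r y) with hxy | hxy | hxy
        · exact ⟨.inl (⟨x, y, hy, hxy⟩, 0), by simp [g]⟩
        · exact absurd (hr hxy) hy.ne
        · exact ⟨.inl (⟨y, x, hy.symm, hxy⟩, 1), by
            simpa [g] using h _ _ _ (hp ⟨y, x, hy.symm, hxy⟩) hy.symm⟩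
      · exact ⟨.inr ⟨x, not_exists.mp hx⟩, rfl⟩
  let e₁ := Equiv.ofBijective g hg
  let e₂ : (Fin (Fintype.card L) × Fin 2) ⊕ Fin (Fintype.card F) ≃ (L × Fin 2) ⊕ F :=
    Equiv.sumCongr (Equiv.prodCongr (Fintype.equivFin L).symm (Equiv.refl _))
      (Fintype.equivFin F).symm
  have key : ∀ (x : L) (a : Fin 2) (y : L) (b : Fin 2),
      G.Adj (g (.inl (x, a))) (g (.inl (y, b))) ↔ x = y ∧ a ≠ b := by
    intro x a y b
    fin_cases a <;> fin_cases b <;> simp [g]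
    · exact fun hxy => hpL y x (h _ _ _ hxy (hp x))
    · exact ⟨fun hxy => hpp _ _ (h _ _ _ (hp x) hxy), fun hxy => hxy ▸ hp x⟩
    · exact ⟨fun hxy => (hpp _ _ (h _ _ _ (hp y) hxy.symm)).symm, fun hxy => hxy ▸ (hp x).symm⟩
    · exact fun hxy => hpL x y (h _ _ _ (hp x).symm hxy)
  refine ⟨Fintype.card L, Fintype.card F, e₂.trans e₁, fun i a j b => ?_, fun z x => ?_⟩
  · refine (key _ _ _ _).trans ?_
    simp
  · exact ((Fintype.equivFin F).symm z).2 x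

/-- Deleting `v` leaves disjoint edges and isolated vertices; restoring `v` turns them into
triangles and pendant edges. -/
theorem exists_iso_triangleBundle {V : Type*} [Fintype V] (G : SimpleGraph V) (v : V)
    (hv : ∀ u, u ≠ v → G.Adj v u)
    (h : ∀ x y z, x ≠ v → y ≠ v → z ≠ v → G.Adj x y → G.Adj x z → y = z) :
    ∃ s k : ℕ, Nonempty (G ≃g triangleBundle s k) := by
  classical
  obtain ⟨s, k, e, h1, h2⟩ := exists_equiv_of_subsingleton_neighbors
    (G.comap (Subtype.val : {x // x ≠ v} → V))
    fun x y z hxy hxz => Subtype.ext (h _ _ _ x.2 y.2 z.2 hxy hxz)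
  refine ⟨s, k, ⟨RelIso.symm ⟨(Equiv.optionCongr e).trans (Equiv.optionSubtypeNe v), ?_⟩⟩⟩
  rintro (_ | ⟨⟨i, a⟩ | x⟩) (_ | ⟨⟨j, b⟩ | y⟩)
  · simp [triangleBundle]
  · simp [triangleBundle]
    exact hv _ (e _).2
  · simp [triangleBundle]
    exact hv _ (e _).2
  · simp [triangleBundle]
    exact (hv _ (e _).2).symm
  · simpa [triangleBundle] using h1 i a j b
  · simpa [triangleBundle] using fun h => h2 y _ h.symm
  · simp [triangleBundle]
    exact (hv _ (e _).2).symm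
  · simpa [triangleBundle] using h2 x _
  · simpa [triangleBundle] using h2 x _

end SimpleGraph

/-! ### Cacti without a dominating vertex. -/

namespace SimpleGraph

variable {V : Type*} [Fintype V] {G : SimpleGraph V}

open Finset in
open Classical in
/-- In a cactus, the degrees of the neighbours of a non-dominating vertex `v` sum up to at most
`deg v * (|V| - deg v)`, unless `v` misses just one other vertex and lies in `deg v / 2`
triangles. -/
theorem IsCactus.sum_degree_neighbors_le (hG : G.IsCactus) (v : V) {r : ℕ} (hr : 1 ≤ r)
    (hcard : Fintype.card V = G.degree v + 1 + r) (hpos : 0 < G.degree v)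
    (hex : r = 1 → ∃ u, G.Adj v u ∧ ∀ y, G.Adj v y → ¬ G.Adj u y) :
    ∑ u ∈ G.neighborFinset v, G.degree u ≤ G.degree v * (r + 1) := by
  set N := G.neighborFinset v with hN
  set R : Finset V := univ.filter fun x => x ≠ v ∧ ¬ G.Adj v x with hR
  -- `W` collects the vertices opposite to `v` in some quadrangle.
  set W : Finset V := R.filter fun w => 2 ≤ #{u ∈ N | G.Adj u w} with hW
  have hNd : #N = G.degree v := G.card_neighborFinset_eq_degree v
  have hRc : #R = r := by
    have h1 : #N + #R + 1 = Fintype.card V := by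
      rw [← card_univ, ← card_erase_add_one (mem_univ v), ← card_union_of_disjoint]
      · congr 2
        ext x
        have : G.Adj v x → x ≠ v := fun h => h.ne'
        simp [hN, hR]
        tauto
      · rw [Finset.disjoint_left]
        simp [hN, hR]
        tauto
    omega
  have hdeg : ∀ u ∈ N, G.degree u = 1 + #{y ∈ N | G.Adj u y} + #{y ∈ R | G.Adj u y} := by
    intro u hu
    have hu' : G.Adj v u := by simpa [hN] using hu
    rw [← card_neighborFinset_eq_degree, add_assoc, ← card_union_of_disjoint, add_comm,
      ← card_insert_of_notMem (a := v)]
    · congr 1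
      ext x
      have : G.Adj u v := hu'.symm
      have : x = v → G.Adj u x := by rintro rfl; exact this
      simp [hN, hR]
      tauto
    · simp [hN, hR]
    · rw [Finset.disjoint_left]
      simp [hN, hR]
      tauto
  -- A neighbour of `u` in `N` gives a triangle on the edge `vu`, one in `W` a quadrangle; the
  -- cactus allows only one of these.
  have hle : ∀ u ∈ N, #{y ∈ N | G.Adj u y} + #{y ∈ W | G.Adj u y} ≤ 1 := by
    intro u hu
    have hu' : G.Adj v u := by simpa [hN] using hu
    rw [← card_union_of_disjoint, card_le_one]
    · have aux : ∀ y ∈ {y ∈ N | G.Adj u y} ∪ {y ∈ W | G.Adj u y}, G.Adj u y ∧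
          (G.Adj v y ∨ (y ≠ v ∧ ¬ G.Adj v y ∧ ∃ t, t ≠ u ∧ G.Adj v t ∧ G.Adj y t)) := by
        intro y hy
        rcases mem_union.mp hy with hy | hy
        · rw [mem_filter] at hy
          exact ⟨hy.2, .inl (by simpa [hN] using hy.1)⟩
        · rw [mem_filter, hW, mem_filter, hR, mem_filter] at hy
          obtain ⟨⟨⟨-, h1, h2⟩, h3⟩, h4⟩ := hy
          obtain ⟨t, ht, htu⟩ := exists_mem_ne (show 1 < #{u ∈ N | G.Adj u y} from h3) u
          rw [mem_filter, hN, mem_neighborFinset] at ht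
          exact ⟨h4, .inr ⟨h1, h2, t, htu, ht.1, ht.2.symm⟩⟩
      exact fun y hy z hz => hG.eq_of_short_cycles hu' (aux y hy).1 (aux z hz).1 (aux y hy).2
        (aux z hz).2
    · rw [Finset.disjoint_left]
      simp [hN, hR, hW]
      tauto
  set A := ∑ u ∈ N, #{y ∈ N | G.Adj u y} with hA
  set C := ∑ w ∈ W, #{u ∈ N | G.Adj u w} with hC
  have hdc : ∀ S : Finset V, ∑ u ∈ N, #{y ∈ S | G.Adj u y} = ∑ w ∈ S, #{u ∈ N | G.Adj u w} :=
    fun S => sum_card_bipartiteAbove_eq_sum_card_bipartiteBelow G.Adj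
  have hAC : A + C ≤ #N := by
    rw [hA, hC, ← hdc, ← sum_add_distrib, card_eq_sum_ones]
    exact sum_le_sum hle
  have hCW : 2 * #W ≤ C := by
    rw [hC, mul_comm, ← smul_eq_mul]
    exact card_nsmul_le_sum _ _ _ fun w hw => (mem_filter.mp hw).2
  have hWR : #W ≤ r := hRc ▸ card_filter_le _ _
  have hRsum : ∑ w ∈ R, #{u ∈ N | G.Adj u w} ≤ C + (r - #W) := by
    rw [← sum_filter_add_sum_filter_not R (fun w => 2 ≤ #{u ∈ N | G.Adj u w})]
    refine Nat.add_le_add_left ?_ C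
    have h2 := card_filter_add_card_filter_not (s := R) (fun w => 2 ≤ #{u ∈ N | G.Adj u w})
    refine (sum_le_card_nsmul _ _ 1 fun w hw => ?_).trans ?_
    · have := (mem_filter.mp hw).2
      omega
    · rw [smul_eq_mul, mul_one]
      rw [hRc] at h2
      exact Nat.le_sub_of_add_le (by rw [add_comm]; exact h2.le)
  have htot : ∑ u ∈ N, G.degree u ≤ #N + A + (C + (r - #W)) := by
    rw [sum_congr rfl hdeg, sum_add_distrib, sum_add_distrib, hdc R, ← card_eq_sum_ones]
    exact Nat.add_le_add_left hRsum _
  refine htot.trans ?_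
  rw [← hNd] at hpos ⊢
  -- As `A + C ≤ #N`, it suffices that `#N + r - #W ≤ #N * r`. This fails only if `r = 1` and `W` is
  -- empty, where `hex` yields `A < #N`, or if `#N = 1`, where `A` and `C` vanish.
  rcases Nat.lt_or_ge 1 #N with hd | hd
  · rcases Nat.lt_or_ge 1 r with hr2 | hr2
    · have : #N + r ≤ #N * r := by nlinarith
      have : #N * (r + 1) = #N * r + #N := by ring
      omega
    · obtain rfl : r = 1 := by omega
      by_cases hW0 : #W = 0
      · have hC0 : C = 0 := by rw [hC, card_eq_zero.mp hW0, sum_empty]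
        obtain ⟨u, hu, hun⟩ := hex rfl
        have : A < #N := by
          rw [hA, card_eq_sum_ones]
          refine sum_lt_sum (fun u hu => by have := hle u hu; omega)
            ⟨u, by simpa [hN] using hu, ?_⟩
          rw [Nat.lt_one_iff, card_eq_zero, filter_eq_empty_iff]
          exact fun y hy => hun y (by simpa [hN] using hy)
        omega
      · omega
  · have h1 : #N = 1 := by omega
    have hA0 : A = 0 := by
      rw [hA]
      refine sum_eq_zero fun u hu => ?_
      rw [card_eq_zero, filter_eq_empty_iff]
      intro y hy
      rw [card_le_one.mp hd y hy u hu]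
      exact G.irrefl
    have hW0 : #W = 0 := by omega
    have hC0 : C = 0 := by rw [hC, card_eq_zero.mp hW0, sum_empty]
    rw [h1]
    omega

/-- A cactus in which the neighbours of `v` are paired off by triangles and exactly one vertex
is not adjacent to `v` has a perfect matching. -/
theorem IsCactus.card_le_two_mul_matchingNumber (hG : G.IsCactus) {v w : V} (hwv : w ≠ v)
    (hw : ∀ x, x ≠ v → (G.Adj v x ↔ x ≠ w))
    (htri : ∀ u, G.Adj v u → ∃ y, G.Adj v y ∧ G.Adj u y) :
    Fintype.card V ≤ 2 * G.matchingNumber := by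
  classical
  have hvw : ¬ G.Adj v w := fun h => (hw w hwv).mp h rfl
  obtain ⟨z, hwz⟩ : ∃ z, G.Adj w z := by
    have : Nontrivial V := ⟨w, v, hwv⟩
    exact hG.1.preconnected.exists_adj_of_nontrivial w
  have hzv : z ≠ v := by
    rintro rfl
    exact hvw hwz.symm
  have hvz : G.Adj v z := (hw z hzv).mpr hwz.ne'
  choose! p hp hup using htri
  have huniq : ∀ u y, G.Adj v u → G.Adj v y → G.Adj u y → y = p u := fun u y hu hy huy =>
    hG.eq_of_short_cycles hu huy (hup u hu) (.inl hy) (.inl (hp u hu))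
  have hpp : ∀ u, G.Adj v u → p (p u) = u := fun u hu =>
    (huniq (p u) u (hp u hu) hu (hup u hu).symm).symm
  -- Start from the pairing `p` of the neighbours of `v`. The missed vertex `w` takes its neighbour
  -- `z`, and the abandoned partner `p z` is matched with `v`.
  let f : V → V := fun x =>
    if x = v then p z else if x = w then z else if x = z then w else if x = p z then v else p x
  have hpz := hp z hvz
  have hzpz := hup z hvz
  have hadj : ∀ x, G.Adj x (f x) := by
    intro x
    by_cases h1 : x = v
    · simpa [f, h1] using hpz
    by_cases h2 : x = w
    · simpa [f, h2, hwv] using hwz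
    by_cases h3 : x = z
    · simpa [f, h3, hzv, hwz.ne'] using hwz.symm
    by_cases h4 : x = p z
    · have : f x = v := by simp only [f, if_neg h1, if_neg h2, if_neg h3, if_pos h4]
      rw [this, h4]
      exact hpz.symm
    · simpa [f, h1, h2, h3, h4] using hup x ((hw x h1).mpr h2)
  have hinv : Function.Involutive f := by
    intro x
    by_cases h1 : x = v
    · have h2 : f x = p z := by simp [f, h1]
      rw [h2, h1]
      have : p z ≠ w := by
        intro h
        exact hvw (h ▸ hpz)
      simp [f, hpz.ne', this, hzpz.ne']
    by_cases h2 : x = w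
    · simp [f, h2, hwv, hzv, hwz.ne']
    by_cases h3 : x = z
    · simp [f, h3, hzv, hwz.ne', hwv]
    by_cases h4 : x = p z
    · have : f x = v := by simp only [f, if_neg h1, if_neg h2, if_neg h3, if_pos h4]
      rw [this, h4]
      simp [f]
    · have hx := (hw x h1).mpr h2
      have h5 : f x = p x := by simp [f, h1, h2, h3, h4]
      have h6 : p x ≠ v := (hp x hx).ne'
      have h7 : p x ≠ w := fun h => hvw (h ▸ hp x hx)
      have h8 : p x ≠ z := fun h => h4 (by rw [← h, hpp x hx])
      have h9 : p x ≠ p z := fun h => h3 (by rw [← hpp x hx, h, hpp z hvz])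
      rw [h5]
      simp only [f, if_neg h6, if_neg h7, if_neg h8, if_neg h9, hpp x hx]
  have := G.card_moved_le_two_mul_matchingNumber hinv fun x _ => hadj x
  rwa [Finset.filter_true_of_mem fun x _ => (hadj x).ne', Finset.card_univ] at this

open Classical in
/-- A cactus without dominating vertex and without perfect matching has signless Laplacian
spectral radius at most its number of vertices. -/
theorem IsCactus.signlessRadius_le_card (hG : G.IsCactus)
    (hdom : ∀ v, ∃ w, w ≠ v ∧ ¬ G.Adj v w) (hm : 2 * G.matchingNumber < Fintype.card V) :
    G.signlessRadius ≤ Fintype.card V := by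
  have hdeg : ∀ v, 0 < G.degree v := by
    intro v
    obtain ⟨w, hwv, -⟩ := hdom v
    have : Nontrivial V := ⟨w, v, hwv⟩
    exact hG.1.preconnected.degree_pos_of_nontrivial v
  refine G.signlessRadius_le (y := fun v => G.degree v) (fun v => by exact_mod_cast hdeg v)
    (Nat.cast_nonneg _) fun v => ?_
  obtain ⟨w, hwv, hvw⟩ := hdom v
  have hlt : G.degree v + 1 < Fintype.card V := by
    have h1 : (insert v (insert w (G.neighborFinset v))).card = G.degree v + 2 := by
      rw [Finset.card_insert_of_notMem, Finset.card_insert_of_notMem,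
        card_neighborFinset_eq_degree]
      · simpa using hvw
      · simpa using hwv.symm
    have h2 := Finset.card_le_univ (insert v (insert w (G.neighborFinset v)))
    omega
  obtain ⟨r, hr⟩ := Nat.exists_eq_add_of_le hlt.le
  have hsum := hG.sum_degree_neighbors_le v (r := r) (by omega) hr (hdeg v) (by
    rintro rfl
    -- If every neighbour of `v` lay in a triangle with `v`, there would be a perfect matching,
    -- against `hm`.
    by_contra! hcon
    refine absurd (hG.card_le_two_mul_matchingNumber hwv (fun x hx => ⟨?_, fun hxw => ?_⟩) hcon)
      (by omega)
    · rintro h rfl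
      exact hvw h
    · by_contra hvx
      have h1 : (insert x (insert v (insert w (G.neighborFinset v)))).card = G.degree v + 3 := by
        rw [Finset.card_insert_of_notMem, Finset.card_insert_of_notMem,
          Finset.card_insert_of_notMem, card_neighborFinset_eq_degree]
        · simpa using hvw
        · simpa using hwv.symm
        · simp [hx, hxw, hvx]
      have h2 := Finset.card_le_univ (insert x (insert v (insert w (G.neighborFinset v))))
      omega)
  have : G.degree v * G.degree v + ∑ u ∈ G.neighborFinset v, G.degree u
      ≤ Fintype.card V * G.degree v := by
    rw [hr]
    nlinarith
  exact_mod_cast this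

/-- A connected graph without dominating vertex has two disjoint edges. -/
theorem Connected.two_le_matchingNumber (hG : G.Connected)
    (hdom : ∀ v, ∃ w, w ≠ v ∧ ¬ G.Adj v w) : 2 ≤ G.matchingNumber := by
  classical
  have := hG.nonempty
  -- On a path `v, u, w` with `w` not adjacent to `v`, `u` has degree at least 2; maximality passes
  -- this to `v`, giving a second neighbour `t` and the disjoint edges `uw`, `vt`.
  obtain ⟨v, hv⟩ := Finite.exists_max fun v => G.degree v
  obtain ⟨w₀, hw₀, hvw₀⟩ := hdom v
  obtain ⟨u, w, hvu, huw, hwv, hvw⟩ : ∃ u w, G.Adj v u ∧ G.Adj u w ∧ w ≠ v ∧ ¬ G.Adj v w := by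
    by_contra! hcon
    have : ∀ x, G.Reachable v x → x = v ∨ G.Adj v x := by
      rintro x ⟨p⟩
      induction p using Walk.concatRec with
      | Hnil => exact .inl rfl
      | @Hconcat a b c p h ih =>
        rcases ih hv hw₀ hvw₀ hcon with rfl | hb
        · exact .inr h
        · by_cases hca : c = a
          · exact .inl hca
          · exact .inr (hcon b c hb h hca)
    rcases this w₀ (hG v w₀) with h | h
    · exact hw₀ h
    · exact hvw₀ h
  have h2 : 2 ≤ G.degree v := by
    refine le_trans ?_ (hv u)
    rw [← card_neighborFinset_eq_degree, ← Finset.card_pair hwv.symm]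
    refine Finset.card_le_card fun x hx => ?_
    simp only [Finset.mem_insert, Finset.mem_singleton] at hx
    rcases hx with rfl | rfl
    · simpa using hvu.symm
    · simpa using huw
  obtain ⟨t, ht, htu⟩ := Finset.exists_mem_ne
    (by rw [card_neighborFinset_eq_degree]; omega : 1 < (G.neighborFinset v).card) u
  rw [mem_neighborFinset] at ht
  have htw : t ≠ w := by
    rintro rfl
    exact hvw ht
  have hne : v ≠ t := ht.ne
  have huwne : u ≠ w := huw.ne
  have hvune : v ≠ u := hvu.ne
  have hs : ∀ x, (Equiv.swap u w * Equiv.swap v t) x =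
      if x = u then w else if x = w then u else if x = v then t else if x = t then v else x := by
    intro x
    rw [Equiv.Perm.mul_apply]
    simp only [Equiv.swap_apply_def]
    grind
  have key := G.card_moved_le_two_mul_matchingNumber (f := Equiv.swap u w * Equiv.swap v t)
    (fun x => by simp only [hs]; grind) (fun x hx => by
      have := hvu.symm
      have := huw.symm
      have := ht.symm
      rw [hs] at hx ⊢
      grind)
  have h4 : ({u, w, v, t} : Finset V).card = 4 := by
    rw [Finset.card_insert_of_notMem, Finset.card_insert_of_notMem, Finset.card_pair hne]
    · simp [hwv, htw.symm]
    · simp [huwne, hvune.symm, htu.symm]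
  have h5 : ({u, w, v, t} : Finset V) ⊆
      Finset.univ.filter fun x => (Equiv.swap u w * Equiv.swap v t) x ≠ x := by
    intro x hx
    simp only [Finset.mem_filter, Finset.mem_univ, true_and, hs]
    simp only [Finset.mem_insert, Finset.mem_singleton] at hx
    grind
  have := Finset.card_le_card h5
  omega

end SimpleGraph

/-! ### Radius and matchings of triangle bundles. -/

namespace SimpleGraph

open Classical in
/-- The action of the signless Laplacian of a triangle bundle on a vector that is constant on
the triangle vertices and on the pendant vertices. -/
theorem triangleBundle_signless_apply (s k : ℕ) (c t p : ℝ) (v) :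
    ((triangleBundle s k).degree v : ℝ) * (Option.elim v c (Sum.elim (fun _ => t) fun _ => p)) +
      ∑ u ∈ (triangleBundle s k).neighborFinset v,
        (Option.elim u c (Sum.elim (fun _ => t) fun _ => p)) =
    Option.elim v ((2 * s + k) * c + (2 * s * t + k * p))
      (Sum.elim (fun _ => 3 * t + c) fun _ => p + c) := by
  have hdeg : ((triangleBundle s k).degree v : ℝ) =
      ∑ u, if (triangleBundle s k).Adj v u then (1 : ℝ) else 0 := by
    rw [← card_neighborFinset_eq_degree, neighborFinset_eq_filter]
    simp
  rw [hdeg, neighborFinset_eq_filter, Finset.sum_filter]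
  rcases v with _ | ⟨⟨i, a⟩ | x⟩
  · simp [Fintype.sum_option, triangleBundle, Fintype.sum_sum_type]
    ring
  · have hi : ∀ j b, (triangleBundle s k).Adj (some (.inl (i, a))) (some (.inl (j, b))) ↔
        i = j ∧ a ≠ b := fun _ _ => Iff.rfl
    have hr : ∀ x, ¬ (triangleBundle s k).Adj (some (.inl (i, a))) (some (.inr x)) :=
      fun _ h => h
    have hn : (triangleBundle s k).Adj (some (.inl (i, a))) none := trivial
    have h : ∀ z : ℝ, (∑ q : Fin s × Fin 2,
        if (triangleBundle s k).Adj (some (.inl (i, a))) (some (.inl q)) then z else 0) = z := by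
      intro z
      rw [Fintype.sum_prod_type, Finset.sum_eq_single i]
      · simp only [hi, true_and]
        fin_cases a <;> simp
      · intro j _ hj
        simp [hi, hj.symm]
      · simp
    simp only [Fintype.sum_option, Fintype.sum_sum_type, Option.elim, Sum.elim_inl, Sum.elim_inr,
      h, hr, hn, if_true, if_false, Finset.sum_const_zero]
    ring
  · simp [Fintype.sum_option, triangleBundle]

theorem card_triangleBundle (s k : ℕ) :
    Fintype.card (Option ((Fin s × Fin 2) ⊕ Fin k)) = 2 * s + k + 1 := by
  simp
  ring

/-- With centre value `c`, the eigenvalue equations at triangle and pendant vertices force `c / (q -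
3)` and `c / (q - 1)`; clearing denominators gives the test vector. The row of the centre then
becomes the cubic condition. -/
theorem triangleBundle_signlessRadius_le {s k n : ℕ} (hn : 2 * s + k + 1 = n) {q : ℝ}
    (hq : 3 < q) (h : 4 * s ≤ q * (q - 3) * (q - n)) :
    (triangleBundle s k).signlessRadius ≤ q := by
  have hk : (k : ℝ) = n - 1 - 2 * s := by
    rw [← hn]
    push_cast
    ring
  refine signlessRadius_le _
    (y := fun v => Option.elim v ((q - 1) * (q - 3)) (Sum.elim (fun _ => q - 1) fun _ => q - 3))
    ?_ (by linarith) fun v => ?_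
  · rintro (_ | ⟨_ | _⟩) <;> simp <;> nlinarith
  · rw [triangleBundle_signless_apply]
    rcases v with _ | ⟨_ | _⟩ <;> simp
    · rw [hk]
      linarith
    · linarith
    · linarith

theorem triangleBundle_signlessRadius_eq {s k n : ℕ} (hn : 2 * s + k + 1 = n) {q : ℝ}
    (hq : 3 < q) (h : q * (q - 3) * (q - n) = 4 * s) :
    (triangleBundle s k).signlessRadius = q := by
  have hk : (k : ℝ) = n - 1 - 2 * s := by
    rw [← hn]
    push_cast
    ring
  refine signlessRadius_eq _
    (y := fun v => Option.elim v ((q - 1) * (q - 3)) (Sum.elim (fun _ => q - 1) fun _ => q - 3))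
    ?_ fun v => ?_
  · rintro (_ | ⟨_ | _⟩) <;> simp <;> nlinarith
  · rw [triangleBundle_signless_apply]
    rcases v with _ | ⟨_ | _⟩ <;> simp
    · rw [hk]
      linarith
    · linarith
    · linarith

theorem triangleBundle_signlessRadius_lt {s k n : ℕ} (hn : 2 * s + k + 1 = n) {q : ℝ}
    (hq : 3 < q) (h : 4 * s < q * (q - 3) * (q - n)) :
    (triangleBundle s k).signlessRadius < q := by
  have hcont : Continuous fun x : ℝ => x * (x - 3) * (x - n) := by fun_prop
  -- The strict inequality persists slightly to the left of `q`, where the weak bound applies.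
  have hev : ∀ᶠ x in nhdsWithin q (Set.Iio q), 3 < x ∧ 4 * (s : ℝ) < x * (x - 3) * (x - n) :=
    nhdsWithin_le_nhds ((lt_mem_nhds hq).and (hcont.continuousAt.eventually (lt_mem_nhds h)))
  obtain ⟨x, ⟨hx3, hx⟩, hxq⟩ := (hev.and self_mem_nhdsWithin).exists
  exact (triangleBundle_signlessRadius_le hn hx3 hx.le).trans_lt hxq

/-- The largest root of the polynomial `x (x - 3) (x - n) - 4 s`. -/
theorem exists_root_ge {n : ℕ} (hn : 4 ≤ n) (s : ℕ) :
    ∃ q : ℝ, n ≤ q ∧ q * (q - 3) * (q - n) = 4 * s := by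
  have hn' : (4 : ℝ) ≤ n := by exact_mod_cast hn
  have hs : (0 : ℝ) ≤ s := Nat.cast_nonneg s
  have hcont : ContinuousOn (fun x : ℝ => x * (x - 3) * (x - n)) (Set.Icc n (n + s)) := by
    fun_prop
  -- The cubic vanishes at `n`; at `n + s` its last factor is `s` and the others have product at
  -- least 4.
  obtain ⟨q, hq, hqs⟩ := intermediate_value_Icc (by linarith) hcont
    (show 4 * (s : ℝ) ∈ _ from ⟨by simp, by
      have : 4 ≤ ((n : ℝ) + s) * (n + s - 3) := by nlinarith
      nlinarith⟩)
  exact ⟨q, hq.1, hqs⟩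

/-- A triangle bundle has a matching using one edge of every triangle, and one more edge if
there is a pendant edge. -/
theorem Iso.card_triangles_le_matchingNumber {V : Type*} [Fintype V] {G : SimpleGraph V}
    {s k : ℕ} (e : G ≃g triangleBundle s k) : s + min k 1 ≤ G.matchingNumber := by
  classical
  rcases k with _ | k
  · let f : Option ((Fin s × Fin 2) ⊕ Fin 0) → Option ((Fin s × Fin 2) ⊕ Fin 0) :=
      Option.map (Sum.map (fun x => (x.1, 1 - x.2)) id)
    have := e.card_moved_le_two_mul_matchingNumber (f := f) (by
      rintro (_ | ⟨⟨i, a⟩ | x⟩) <;> simp [f]) (by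
      rintro (_ | ⟨⟨i, a⟩ | x⟩) h
      · simp [f] at h
      · fin_cases a <;> simp [f, triangleBundle]
      · exact x.elim0)
    have h2 : (Finset.univ.filter fun x => f x ≠ x) = Finset.univ.erase none := by
      ext x
      rcases x with _ | ⟨⟨i, a⟩ | x⟩
      · simp [f]
      · fin_cases a <;> simp [f]
      · exact x.elim0
    rw [h2, Finset.card_erase_of_mem (Finset.mem_univ _), Finset.card_univ,
      card_triangleBundle] at this
    omega
  · let f : Option ((Fin s × Fin 2) ⊕ Fin (k + 1)) → Option ((Fin s × Fin 2) ⊕ Fin (k + 1))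
      | none => some (.inr 0)
      | some (.inl (i, a)) => some (.inl (i, 1 - a))
      | some (.inr x) => if x = 0 then none else some (.inr x)
    have := e.card_moved_le_two_mul_matchingNumber (f := f) (by
      rintro (_ | ⟨⟨i, a⟩ | x⟩)
      · simp [f]
      · simp [f]
      · by_cases hx : x = 0 <;> simp [f, hx]) (by
      rintro (_ | ⟨⟨i, a⟩ | x⟩) h
      · simp [f, triangleBundle]
      · fin_cases a <;> simp [f, triangleBundle]
      · by_cases hx : x = 0 <;> simp [f, hx, triangleBundle] at h ⊢)
    let g : Option (Option (Fin s × Fin 2)) → Option ((Fin s × Fin 2) ⊕ Fin (k + 1))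
      | none => none
      | some none => some (.inr 0)
      | some (some x) => some (.inl x)
    have h2 := Finset.card_le_card_of_injOn (s := Finset.univ)
      (t := Finset.univ.filter fun x => f x ≠ x) g (by
        rintro (_ | _ | ⟨i, a⟩) -
        · simp [g, f]
        · simp [g, f]
        · fin_cases a <;> simp [g, f]) (by
        rintro (_ | _ | x) - (_ | _ | y) - <;> simp [g])
    simp only [Finset.card_univ, Fintype.card_option, Fintype.card_prod, Fintype.card_fin] at h2
    omega

end SimpleGraph

/-! ### The extremal comparison. -/

theorem theorem3p1 {V : Type*} [Fintype V] (G : SimpleGraph V) (n m : ℕ)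
    (hG : G.IsCactus) (hn : Fintype.card V = n) (hm : G.matchingNumber = m) (hm1 : 1 ≤ m) :
    (n = 2 * m + 1 →
      G.signlessRadius ≤ (((n : ℝ) + 2) + √((n : ℝ) ^ 2 - 4 * n + 12)) / 2 ∧
      (G.signlessRadius = (((n : ℝ) + 2) + √((n : ℝ) ^ 2 - 4 * n + 12)) / 2 ↔
        Nonempty (G ≃g SimpleGraph.triangleBundle m 0))) ∧
    (2 * m + 2 ≤ n →
      G.signlessRadius ≤ (SimpleGraph.triangleBundle (m - 1) (n - 2 * m + 1)).signlessRadius ∧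
      (G.signlessRadius = (SimpleGraph.triangleBundle (m - 1) (n - 2 * m + 1)).signlessRadius ↔
        Nonempty (G ≃g SimpleGraph.triangleBundle (m - 1) (n - 2 * m + 1))) ∧
      IsGreatest {x : ℝ | x ^ 3 - ((n : ℝ) + 3) * x ^ 2 + 3 * (n : ℝ) * x - 4 * (m : ℝ) + 4 = 0}
        (SimpleGraph.triangleBundle (m - 1) (n - 2 * m + 1)).signlessRadius) := by
  subst hm
  set m := G.matchingNumber with hm
  have hcases : (2 * m < n →
      G.signlessRadius ≤ n ∧ 2 ≤ m) ∨
      ∃ s k : ℕ, 2 * s + k + 1 = n ∧ s + min k 1 ≤ m ∧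
        Nonempty (G ≃g SimpleGraph.triangleBundle s k) := by
    by_cases hdom : ∀ v, ∃ w, w ≠ v ∧ ¬ G.Adj v w
    · left
      intro h
      rw [← hn] at h ⊢
      exact ⟨hG.signlessRadius_le_card hdom h, hG.1.two_le_matchingNumber hdom⟩
    · right
      push Not at hdom
      obtain ⟨v, hv⟩ := hdom
      obtain ⟨s, k, ⟨e⟩⟩ := G.exists_iso_triangleBundle v hv fun x y z hx hy hz hxy hxz =>
        hG.eq_of_short_cycles (hv x hx) hxy hxz (.inl (hv y hy)) (.inl (hv z hz))
      refine ⟨s, k, ?_, e.card_triangles_le_matchingNumber, ⟨e⟩⟩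
      rw [← hn, ← SimpleGraph.card_triangleBundle]
      exact (Fintype.card_congr e.toEquiv).symm
  /- comparison with a root `q` of the characteristic equation of `triangleBundle t l` -/
  have hcomp : ∀ (t l : ℕ) (q : ℝ), 2 * t + l + 1 = n → 2 * m < n → 3 < q →
      (2 ≤ m → (n : ℝ) < q) → q * (q - 3) * (q - n) = 4 * t →
      (∀ s k : ℕ, 2 * s + k + 1 = n → s + min k 1 ≤ m → s ≤ t) →
      G.signlessRadius ≤ q ∧
        (G.signlessRadius = q ↔ Nonempty (G ≃g SimpleGraph.triangleBundle t l)) := by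
    intro t l q htl hmn hq hqn hroot hst
    have hiso : Nonempty (G ≃g SimpleGraph.triangleBundle t l) → G.signlessRadius = q :=
      fun ⟨e⟩ => e.signlessRadius_eq.trans
        (SimpleGraph.triangleBundle_signlessRadius_eq htl hq hroot)
    by_cases hlt : G.signlessRadius < q
    · exact ⟨hlt.le, fun h => absurd h hlt.ne, hiso⟩
    · have : Nonempty (G ≃g SimpleGraph.triangleBundle t l) := by
        rcases hcases with h | ⟨s, k, hsk, hskm, ⟨e⟩⟩
        · obtain ⟨h1, h2⟩ := h hmn
          exact absurd (h1.trans_lt (hqn h2)) hlt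
        · rcases (hst s k hsk hskm).lt_or_eq with h | rfl
          · refine absurd ?_ hlt
            rw [e.signlessRadius_eq]
            refine SimpleGraph.triangleBundle_signlessRadius_lt hsk hq ?_
            rw [hroot]
            exact_mod_cast Nat.mul_lt_mul_of_pos_left h (by norm_num)
          · obtain rfl : k = l := by omega
            exact ⟨e⟩
      exact ⟨(hiso this).le, fun _ => this, hiso⟩
  refine ⟨fun hnm => ?_, fun hnm => ?_⟩
  · have hn3 : (3 : ℝ) ≤ n := by exact_mod_cast (by omega : 3 ≤ n)
    have hnm' : (n : ℝ) = 2 * m + 1 := by exact_mod_cast hnm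
    set w := √((n : ℝ) ^ 2 - 4 * n + 12) with hw
    have hw2 : w ^ 2 = (n : ℝ) ^ 2 - 4 * n + 12 := Real.sq_sqrt (by nlinarith)
    have hwn : (n : ℝ) - 2 < w := Real.lt_sqrt_of_sq_lt (by nlinarith)
    refine hcomp m 0 _ (by omega) (by omega) (by linarith) (fun _ => by linarith) ?_
      fun s k h1 h2 => by omega
    -- With `4m = 2(n-1)` the cubic equation becomes `(q-1)(q² - (n+2)q + 2(n-1)) = 0`, and `q` is
    -- the larger root of the quadratic factor.
    have : (m : ℝ) = (n - 1) / 2 := by linarith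
    rw [this]
    linear_combination ((n + 2 + w) / 2 - 1) / 4 * hw2
  · have hn4 : (4 : ℝ) ≤ n := by exact_mod_cast (by omega : 4 ≤ n)
    obtain ⟨q, hqn, hroot⟩ := SimpleGraph.exists_root_ge (by omega : 4 ≤ n) (m - 1)
    have hcast : ((m - 1 : ℕ) : ℝ) = m - 1 := by
      push_cast [hm1]
      rfl
    have hrad := SimpleGraph.triangleBundle_signlessRadius_eq
      (by omega : 2 * (m - 1) + (n - 2 * m + 1) + 1 = n) (by linarith) hroot
    rw [hrad]
    -- For `m = 1` the right side is zero and `q = n`, so strictness needs `2 ≤ m`.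
    have hlt : 2 ≤ m → (n : ℝ) < q := by
      intro h2
      refine lt_of_le_of_ne hqn fun h => ?_
      have h2' : (2 : ℝ) ≤ m := by exact_mod_cast h2
      rw [hcast, ← h, sub_self, mul_zero] at hroot
      linarith
    obtain ⟨h1, h2⟩ := hcomp (m - 1) (n - 2 * m + 1) q (by omega) (by omega)
      (by linarith) hlt hroot fun s k h1 h2 => by omega
    refine ⟨h1, h2, ?_, fun x hx => ?_⟩
    · rw [hcast] at hroot
      change q ^ 3 - _ * q ^ 2 + _ * q - _ + 4 = 0
      linear_combination hroot
    · by_contra! hqx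
      have hx' : x * (x - 3) * (x - n) = 4 * (m - 1 : ℕ) := by
        rw [hcast]
        have : x ^ 3 - ((n : ℝ) + 3) * x ^ 2 + 3 * (n : ℝ) * x - 4 * (m : ℝ) + 4 = 0 := hx
        linear_combination this
      -- Beyond `q ≥ n ≥ 4` both `x(x-3)` and `x-n` increase, so the cubic takes the value `4(m-1)`
      -- at no larger point.
      have ha : q * (q - 3) < x * (x - 3) := by nlinarith
      have hb : q * (q - 3) * (q - n) < x * (x - 3) * (x - n) := by
        have : 0 < x * (x - 3) := by nlinarith
        calc q * (q - 3) * (q - n) ≤ x * (x - 3) * (q - n) :=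
              mul_le_mul_of_nonneg_right ha.le (by linarith)
          _ < _ := mul_lt_mul_of_pos_left (by linarith) this
      linarith
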